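/- Let $m$ and $k$ be odd positive integers with $\gcd(m,k)=1$, let $n=2m$, and write $\overline{x}=x^{2^m}$ for $x\in\mathbb{F}_{2^n}$. For $y\in\mathbb{F}_{2^m}$ let $\mathrm{Tr}_1^m(y)=\sum_{i=0}^{m-1}y^{2^i}\in\mathbb{F}_2$. For $f:\mathbb{F}_{2^n}\to\mathbb{F}_{2^n}$ the differential uniformity is $$\delta(f)=\max_{a\neq 0,\;b}\#\{x\in\mathbb{F}_{2^n}: f(x)+f(x+a)=b\},$$ and for a permutation $f$ of $\mathbb{F}_{2^n}$ the boomerang uniformity is $$\beta(f)=\max_{a,b\neq 0}\#\{x\in\mathbb{F}_{2^n}: f^{-1}(f(x)+b)+f^{-1}(f(x+a)+b)=a\}.$$ For $c=(c_0,c_1,c_2,c_3)\in\mathbb{F}_{2^n}^4$ let $$f_c(x)=c_0\overline{x}^{2^k+1}+c_1\overline{x}^{2^k}x+c_2\overline{x}x^{2^k}+c_3x^{2^k+1},$$ $$\theta_1=c_0\overline{c}_0+c_1\overline{c}_1+c_2\overline{c}_2+c_3\overline{c}_3,\quad \theta_2=\overline{c}_0c_1+\overline{c}_2c_3,\quad \theta_3=c_0\overline{c}_2+c_1\overline{c}_3,\quad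 \theta_4=c_1\overline{c}_1+c_2\overline{c}_2.$$ Let $\Gamma$ be the set of all $c\in\mathbb{F}_{2^n}^4$ with $\theta_1\neq 0$, $\mathrm{Tr}_1^m(\theta_4/\theta_1)=1$ and $(\theta_2/\theta_1)^{2^k}=\overline{\theta}_3/\theta_1$, and for $i\in\{0,1\}$ let $\Gamma_i$ be the set of all $c\in\Gamma$ with $\mathrm{Tr}_1^m(\theta_2\overline{\theta}_2/\theta_1^2)=i$. Then $\Gamma$ is the disjoint union of $\Gamma_0$ and $\Gamma_1$, and: (1) if $c\in\Gamma$, then $f_c$ is a permutation of $\mathbb{F}_{2^n}$; (2) if $c\in\Gamma_0$, then $\beta(f_c)=\delta(f_c)=4$; (3) if $c\in\Gamma_1$, then $\beta(f_c)\ge\delta(f_c)=2^{m+1}$. -/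

import Mathlib

namespace Quadrinomial

/-! Difference distribution table, boomerang connectivity table, and the two uniformities.
In the application the group is the additive group of a field of characteristic two. -/

open Classical in
/-- `DDT_f(a,b)`, the number of `x` with `f(x) + f(x + a) = b`. -/
noncomputable def ddt {V : Type*} [AddCommGroup V] [Fintype V] (f : V → V) (a b : V) : ℕ :=
  (Finset.univ.filter fun x : V => f x + f (x + a) = b).card

open Classical in
/-- The differential uniformity `δ(f)`: the maximum of `DDT_f(a,b)` over all `a ≠ 0` and all `b`. -/
noncomputable def diffUniformity {V : Type*} [AddCommGroup V] [Fintype V] (f : V → V) : ℕ :=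
  (Finset.univ.filter fun p : V × V => p.1 ≠ 0).sup fun p => ddt f p.1 p.2

open Classical in
/-- `BCT_f(a,b)` for a permutation `f`: the number of `x` with
`f⁻¹(f(x) + b) + f⁻¹(f(x + a) + b) = a`. -/
noncomputable def bct {V : Type*} [AddCommGroup V] [Fintype V] (f : Equiv.Perm V) (a b : V) : ℕ :=
  (Finset.univ.filter fun x : V => f.symm (f x + b) + f.symm (f (x + a) + b) = a).card

open Classical in
/-- The boomerang uniformity `β(f)` of a permutation `f`: the maximum of `BCT_f(a,b)` over all
`a ≠ 0` and `b ≠ 0`. -/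
noncomputable def boomUniformity {V : Type*} [AddCommGroup V] [Fintype V]
    (f : Equiv.Perm V) : ℕ :=
  (Finset.univ.filter fun p : V × V => p.1 ≠ 0 ∧ p.2 ≠ 0).sup fun p => bct f p.1 p.2

/-! The quadrinomial and its coefficient sets, for a field `F` with `2 ^ (2 * m)` elements. -/

/-- `x̄ = x ^ (2 ^ m)`. -/
def bar {F : Type*} [Field F] (m : ℕ) (x : F) : F := x ^ 2 ^ m

/-- The trace `Tr_1^m(x) = x + x ^ 2 + x ^ 4 + ⋯ + x ^ (2 ^ (m - 1))` of an element `x` of the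
subfield of order `2 ^ m`; its value is regarded as an element of `F`. -/
def absTrace {F : Type*} [Field F] (m : ℕ) (x : F) : F := ∑ i ∈ Finset.range m, x ^ 2 ^ i

/-- On a subfield `K` of order `2 ^ m`, `absTrace m` is Mathlib's trace from `K` to `ZMod 2`. -/
theorem absTrace_algebraMap {K F : Type*} [Field K] [Finite K] [Field F] [Algebra K F]
    [Algebra (ZMod 2) K] (m : ℕ) (hK : Nat.card K = 2 ^ m) (x : K) :
    absTrace m (algebraMap K F x) =
      algebraMap K F (algebraMap (ZMod 2) K (Algebra.trace (ZMod 2) K x)) := by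
  have h : Module.finrank (ZMod 2) K = m := by
    have h1 := Module.natCard_eq_pow_finrank (K := ZMod 2) (V := K)
    rw [hK, Nat.card_zmod] at h1
    exact (Nat.pow_right_injective le_rfl h1).symm
  rw [FiniteField.algebraMap_trace_eq_sum_pow, h, Nat.card_zmod, absTrace, map_sum]
  simp

/-- `f_c(x) = c₀ x̄^(2^k+1) + c₁ x̄^(2^k) x + c₂ x̄ x^(2^k) + c₃ x^(2^k+1)`. -/
def quad {F : Type*} [Field F] (m k : ℕ) (c : Fin 4 → F) (x : F) : F :=
  c 0 * bar m x ^ (2 ^ k + 1) + c 1 * bar m x ^ 2 ^ k * x + c 2 * bar m x * x ^ 2 ^ k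
    + c 3 * x ^ (2 ^ k + 1)

/-- `θ₁ = c₀ c̄₀ + c₁ c̄₁ + c₂ c̄₂ + c₃ c̄₃`. -/
def theta1 {F : Type*} [Field F] (m : ℕ) (c : Fin 4 → F) : F :=
  c 0 * bar m (c 0) + c 1 * bar m (c 1) + c 2 * bar m (c 2) + c 3 * bar m (c 3)

/-- `θ₂ = c̄₀ c₁ + c̄₂ c₃`. -/
def theta2 {F : Type*} [Field F] (m : ℕ) (c : Fin 4 → F) : F :=
  bar m (c 0) * c 1 + bar m (c 2) * c 3

/-- `θ₃ = c₀ c̄₂ + c₁ c̄₃`. -/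
def theta3 {F : Type*} [Field F] (m : ℕ) (c : Fin 4 → F) : F :=
  c 0 * bar m (c 2) + c 1 * bar m (c 3)

/-- `θ₄ = c₁ c̄₁ + c₂ c̄₂`. -/
def theta4 {F : Type*} [Field F] (m : ℕ) (c : Fin 4 → F) : F :=
  c 1 * bar m (c 1) + c 2 * bar m (c 2)

/-- The set `Γ` of coefficient vectors. -/
def Gam (F : Type*) [Field F] (m k : ℕ) : Set (Fin 4 → F) :=
  {c | theta1 m c ≠ 0 ∧ absTrace m (theta4 m c / theta1 m c) = 1 ∧
    (theta2 m c / theta1 m c) ^ 2 ^ k = bar m (theta3 m c) / theta1 m c}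

/-- `Γ_i`, the set of `c ∈ Γ` with `Tr_1^m(θ₂ θ̄₂ / θ₁²) = i`; it is used for `i = 0, 1`. -/
def GamPart (F : Type*) [Field F] (m k : ℕ) (i : F) : Set (Fin 4 → F) :=
  {c | c ∈ Gam F m k ∧ absTrace m (theta2 m c * bar m (theta2 m c) / theta1 m c ^ 2) = i}

end Quadrinomial

open Quadrinomial

/-! ### Uniformities under additive equivalence -/

section Uniformity

variable {V W : Type*} [AddCommGroup V] [Fintype V] [AddCommGroup W] [Fintype W]

/-! With `M = !![c 0, c 1; c 2, c 3]`, the map f_c is a twisted bilinear form: f_c(x) = Uᵀ M s,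
where s = (x̄, x) and U is its entrywise 2^k-th power. Its conjugate has the same shape, with a
matrix M' made from the conjugated entries. Diagonalising the pair (M, M') splits f_c into simple
pieces.

Put θ = θ₂/θ₁ and a² + a = θθ̄. Up to a scalar matrix, adj M · M' is θ₁ times [[a, θ], [θ̄, a+1]],
which has eigenvalues 0 and 1. The condition relating θ₂ and θ₃ makes the off-diagonal entries of M'
· adj M Frobenius twists of these. The condition Tr(θ₄/θ₁) = 1 fixes its diagonal. Hence left
eigenvectors are 2^k-th powers of right ones (`Gam_exists_halfTrace`, `twistedForm_diagonal`).

If Tr(θθ̄) = 0, then a lies in the subfield, conjugation swaps the two eigenlines, and the twist of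
one eigenvector belongs to the other eigenvalue. So f_c is equivalent to z̄^(2^k) z, a Gold map
whose Frobenius power has fixed field of order 4. If Tr(θθ̄) = 1, then ā = a + 1, each eigenline is
stable under conjugation, eigenvalues match, and f_c is equivalent to two copies of X^(2^k+1) over
the subfield.

Both uniformities are invariant under additive equivalence. It remains to study Gold maps:
`gold_injective`, `ddt_gold_le`, `bct_gold_le`, and the product rule `ddt_prodMap`. -/

theorem ddt_comp (N : V ≃+ W) (L : W ≃+ V) {g : W → W} {f : V → V}
    (h : ∀ x, f x = L (g (N x))) (a b : V) : ddt f a b = ddt g (N a) (L.symm b) := by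
  classical
  unfold ddt
  refine Finset.card_equiv N.toEquiv fun x => ?_
  simp only [Finset.mem_filter, Finset.mem_univ, true_and, h, AddEquiv.toEquiv_eq_coe,
    EquivLike.coe_coe, ← map_add, AddEquiv.eq_symm_apply]

theorem bct_comp (N : V ≃+ W) (L : W ≃+ V) {g : Equiv.Perm W} {f : Equiv.Perm V}
    (h : ∀ x, f x = L (g (N x))) (a b : V) : bct f a b = bct g (N a) (L.symm b) := by
  classical
  have hs : ∀ y, f.symm y = N.symm (g.symm (L.symm y)) := fun y => by
    rw [Equiv.symm_apply_eq, h]; simp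
  unfold bct
  refine Finset.card_equiv N.toEquiv fun x => ?_
  simp only [Finset.mem_filter, Finset.mem_univ, true_and, h, hs, AddEquiv.toEquiv_eq_coe,
    EquivLike.coe_coe, ← map_add, AddEquiv.symm_apply_eq]
  simp

theorem diffUniformity_le {f : V → V} {n : ℕ} (h : ∀ a b, a ≠ 0 → ddt f a b ≤ n) :
    diffUniformity f ≤ n := by
  classical
  unfold diffUniformity
  refine Finset.sup_le fun p hp => h _ _ ?_
  simpa using hp

theorem ddt_le_diffUniformity (f : V → V) {a : V} (b : V) (ha : a ≠ 0) :
    ddt f a b ≤ diffUniformity f := by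
  classical
  unfold diffUniformity
  exact Finset.le_sup (f := fun p : V × V => ddt f p.1 p.2) (b := (a, b)) (by simpa using ha)

theorem boomUniformity_le {f : Equiv.Perm V} {n : ℕ}
    (h : ∀ a b, a ≠ 0 → b ≠ 0 → bct f a b ≤ n) : boomUniformity f ≤ n := by
  classical
  unfold boomUniformity
  refine Finset.sup_le fun p hp => ?_
  have := (Finset.mem_filter.mp hp).2
  exact h _ _ this.1 this.2

theorem bct_le_boomUniformity (f : Equiv.Perm V) {a b : V} (ha : a ≠ 0) (hb : b ≠ 0) :
    bct f a b ≤ boomUniformity f := by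
  classical
  unfold boomUniformity
  exact Finset.le_sup (f := fun p : V × V => bct f p.1 p.2) (b := (a, b)) (by simp [ha, hb])

/-- Over a group of exponent two, the differential uniformity of a permutation is at most its
boomerang uniformity. -/
theorem diffUniformity_le_boomUniformity (h2 : ∀ v : V, v + v = 0) (f : Equiv.Perm V) :
    diffUniformity f ≤ boomUniformity f := by
  classical
  refine diffUniformity_le fun a b ha => ?_
  have hswap : ∀ u v : V, u + v = b → u + b = v := fun u v h => by
    rw [← h, ← add_assoc, h2, zero_add]
  rcases eq_or_ne b 0 with rfl | hb
  · have : ddt f a 0 = 0 := by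
      unfold ddt
      rw [Finset.card_eq_zero, Finset.filter_eq_empty_iff]
      intro x _ hx
      have := f.injective ((add_zero _).symm.trans (hswap _ _ hx))
      exact ha (by simpa using this)
    omega
  · refine le_trans ?_ (bct_le_boomUniformity f ha hb)
    unfold ddt bct
    -- A solution of f(x) + f(x + a) = b satisfies f(x) + b = f(x + a), so adding b merely exchanges
    -- the two values and the boomerang returns.
    refine Finset.card_le_card fun x hx => ?_
    simp only [Finset.mem_filter, Finset.mem_univ, true_and] at hx ⊢
    rw [hswap _ _ hx, hswap _ _ ((add_comm _ _).trans hx), Equiv.symm_apply_apply,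
      Equiv.symm_apply_apply, add_right_comm, h2, zero_add]

theorem ddt_prodMap (g : V → V) (h : W → W) (a b : V × W) :
    ddt (Prod.map g h) a b = ddt g a.1 b.1 * ddt h a.2 b.2 := by
  classical
  unfold ddt
  rw [← Finset.card_product]
  congr 1
  ext x
  simp [Prod.ext_iff]

theorem ddt_le_card (g : V → V) (a b : V) : ddt g a b ≤ Fintype.card V := by
  classical
  exact Finset.card_le_univ _

end Uniformity

/-! ### The maps `x ↦ σ x * x` in characteristic two -/

section Gold

variable {F : Type*} [Field F] [CharP F 2]

/-- Translating by one element of `S` and dividing by `a` embeds `S` into the roots of X^n - X. -/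
theorem card_le_of_div_pow_eq {F : Type*} [Field F] {S : Finset F} {a : F} (ha : a ≠ 0) {n : ℕ}
    (hn : 1 < n) (h : ∀ x ∈ S, ∀ y ∈ S, ((x - y) / a) ^ n = (x - y) / a) : S.card ≤ n := by
  classical
  rcases S.eq_empty_or_nonempty with rfl | ⟨y, hy⟩
  · simp
  have hdeg : (Polynomial.X ^ n - Polynomial.X : Polynomial F).natDegree = n :=
    FiniteField.X_pow_card_sub_X_natDegree_eq F hn
  have hne : (Polynomial.X ^ n - Polynomial.X : Polynomial F) ≠ 0 :=
    FiniteField.X_pow_card_sub_X_ne_zero F hn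
  calc S.card = (S.image fun x => (x - y) / a).card := by
        refine (Finset.card_image_of_injective _ fun u v huv => ?_).symm
        simpa [div_left_inj' ha] using huv
    _ ≤ (Polynomial.X ^ n - Polynomial.X : Polynomial F).roots.toFinset.card := by
        refine Finset.card_le_card fun z hz => ?_
        obtain ⟨x, hx, rfl⟩ := Finset.mem_image.mp hz
        rw [Multiset.mem_toFinset, Polynomial.mem_roots hne]
        simp [h x hx y hy]
    _ ≤ (Polynomial.X ^ n - Polynomial.X : Polynomial F).roots.card := Multiset.toFinset_card_le _
    _ ≤ n := (Polynomial.card_roots' _).trans hdeg.le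

variable [Fintype F] (σ : F →+* F)

/-- The derivative in direction `a` is affine, and a difference of two solutions divided by `a` is
fixed by `σ`. -/
theorem ddt_gold_le {n : ℕ} (hn : 1 < n) (hσ : ∀ y, σ y = y → y ^ n = y) {a : F} (ha : a ≠ 0)
    (b : F) : ddt (fun x => σ x * x) a b ≤ n := by
  classical
  unfold ddt
  refine card_le_of_div_pow_eq ha hn fun x hx y hy => hσ _ ?_
  simp only [Finset.mem_filter, Finset.mem_univ, true_and, map_add] at hx hy
  have ha' : σ a ≠ 0 := by simpa using ha
  rw [map_div₀, map_sub, div_eq_div_iff ha' ha]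
  linear_combination hx - hy - (σ x * x - σ y * y + (x - y) * σ a) * CharTwo.two_eq_zero (R := F)

/-- The four elements 0, 1, ω, ω + 1 are fixed by `σ`, and on fixed points the equation reads 2(x² +
x) + 1 = 1. -/
theorem le_ddt_gold {ω : F} (hω : ω ^ 2 + ω + 1 = 0) (hσ : σ ω = ω) :
    4 ≤ ddt (fun x => σ x * x) 1 1 := by
  classical
  have h2 := CharTwo.two_eq_zero (R := F)
  have hω0 : ω ≠ 0 := by rintro rfl; simp at hω
  have hω1 : ω + 1 ≠ 0 := fun h => by
    have : (1 : F) = 0 := by linear_combination hω - ω * h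
    exact one_ne_zero this
  have hω1' : ω ≠ 1 := fun h => hω1 (by rw [h]; linear_combination h2)
  have hcard : ({0, 1, ω, ω + 1} : Finset F).card = 4 := by
    rw [Finset.card_insert_of_notMem, Finset.card_insert_of_notMem,
      Finset.card_insert_of_notMem, Finset.card_singleton]
    · simp
    · simp [hω1'.symm, hω0]
    · simp [hω0.symm, hω1.symm]
  rw [← hcard]
  unfold ddt
  refine Finset.card_le_card fun x hx => ?_
  have hx' : σ x = x := by
    simp only [Finset.mem_insert, Finset.mem_singleton] at hx
    rcases hx with rfl | rfl | rfl | rfl <;> simp [hσ]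
  simp only [Finset.mem_filter, Finset.mem_univ, true_and, map_add, map_one, hx']
  linear_combination (x ^ 2 + x) * h2

theorem bct_gold_le (g : Equiv.Perm F) (hg : ∀ x, g x = σ x * x) {m : ℕ} (hm : Odd m)
    (hσ : ∀ y, σ y = y → y ^ 4 = y) (hσm : ∀ y, σ^[m] y = y) {a b : F} (ha : a ≠ 0)
    (hb : b ≠ 0) : bct g a b ≤ 4 := by
  classical
  have h2 := CharTwo.two_eq_zero (R := F)
  have ha' : σ a ≠ 0 := by simpa using ha
  -- Write g⁻¹(g(x) + b) = x + aζ. The boomerang condition then says that x + a is sent to x + a +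
  -- aζ, and comparing the two equations forces ζ to be fixed by `σ`.
  have key : ∀ x, g.symm (g x + b) + g.symm (g (x + a) + b) = a →
      ∃ ζ, ζ ≠ 0 ∧ σ ζ = ζ ∧ σ (x / a) + x / a = b / (σ a * a) / ζ + ζ := by
    intro x hx
    obtain ⟨ζ, hζ⟩ : ∃ ζ, ζ = (g.symm (g x + b) - x) / a := ⟨_, rfl⟩
    have hy : g.symm (g x + b) = x + a * ζ := by rw [hζ]; field_simp; ring
    have hy' : g.symm (g (x + a) + b) = x + a * ζ + a := by
      rw [← hy]; linear_combination hx - g.symm (g x + b) * h2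
    rw [Equiv.symm_apply_eq, hg, hg] at hy hy'
    simp only [map_add, map_mul] at hy hy'
    have hfix : σ ζ = ζ := by
      refine mul_left_cancel₀ (mul_ne_zero ha ha') ?_
      linear_combination hy - hy' - (a * σ a * ζ) * h2
    have hb' : b = ζ * (σ x * a + x * σ a + σ a * a * ζ) := by
      rw [hfix] at hy; linear_combination hy
    refine ⟨ζ, fun h => hb (by rw [hb', h, zero_mul]), hfix, ?_⟩
    have hζ0 : ζ ≠ 0 := fun h => hb (by rw [hb', h, zero_mul])
    rw [map_div₀, hb']
    field_simp
    linear_combination (-ζ * a * σ a) * h2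
  unfold bct
  refine card_le_of_div_pow_eq ha (by norm_num) fun x hx y hy => hσ _ ?_
  simp only [Finset.mem_filter, Finset.mem_univ, true_and] at hx hy
  obtain ⟨ζ, hζ0, hζ, hxζ⟩ := key x hx
  obtain ⟨ξ, hξ0, hξ, hyξ⟩ := key y hy
  -- Multiplying each relation by its own ζ or ξ leaves the common term b/(a σ(a)), which cancels in
  -- the sum; so `σ` translates z by the fixed element (ζ + ξ)².
  obtain ⟨z, hz⟩ : ∃ z, z = ζ * (x / a) + ξ * (y / a) := ⟨_, rfl⟩
  have hσz : σ z = z + (ζ + ξ) ^ 2 := by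
    rw [hz, map_add, map_mul, map_mul, hζ, hξ]
    have h1 : ζ * (σ (x / a) + x / a) = b / (σ a * a) + ζ ^ 2 := by
      rw [hxζ]; field_simp
    have h3 : ξ * (σ (y / a) + y / a) = b / (σ a * a) + ξ ^ 2 := by
      rw [hyξ]; field_simp
    linear_combination h1 + h3 + (b / (σ a * a) - ζ * ξ - ζ * (x / a) - ξ * (y / a)) * h2
  have hiter : ∀ j : ℕ, σ^[j] z = z + j * (ζ + ξ) ^ 2 := by
    intro j
    induction j with
    | zero => simp
    | succ j ih =>
      rw [Function.iterate_succ_apply', ih, map_add, map_mul, map_pow, map_add, hζ, hξ, hσz]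
      simp; ring
  -- After an odd number `m` of translations in characteristic two one translation survives, but
  -- `σ^[m]` is the identity. All solutions thus share one ζ.
  have hsum : ζ + ξ = 0 := by
    have h1 := hiter m
    obtain ⟨j, rfl⟩ := hm
    rw [hσm] at h1
    have : (ζ + ξ) ^ 2 = 0 := by
      push_cast at h1
      linear_combination -h1 - j * (ζ + ξ) ^ 2 * h2
    exact pow_eq_zero_iff two_ne_zero |>.mp this
  have hζξ : ξ = ζ := by linear_combination hsum - ζ * h2
  rw [hζξ, ← hxζ] at hyξ
  rw [sub_div, map_sub]
  linear_combination -hyξ + (y / a - x / a) * h2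

end Gold

/-! ### Conjugation, absolute trace and half trace -/

theorem charP_two_of_card {F : Type*} [Field F] [Fintype F] {n : ℕ}
    (hF : Fintype.card F = 2 ^ n) : CharP F 2 :=
  charP_of_card_eq_prime_pow hF

theorem bar_bar {F : Type*} [Field F] [Fintype F] {m : ℕ} (hF : Fintype.card F = 2 ^ (2 * m)) (x : F) :
    bar m (bar m x) = x := by
  rw [bar, bar, ← pow_mul, ← pow_add, ← two_mul, ← hF, FiniteField.pow_card]

theorem absTrace_zero {F : Type*} [Field F] (m : ℕ) : absTrace m (0 : F) = 0 := by simp [absTrace]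

theorem absTrace_pow_two {F : Type*} [Field F] {m : ℕ} {x : F} (hx : bar m x = x) :
    absTrace m (x ^ 2) = absTrace m x := by
  have h := Finset.sum_range_succ' (fun i => x ^ 2 ^ i) m
  rw [Finset.sum_range_succ, show x ^ 2 ^ m = x from hx, pow_zero, pow_one] at h
  rw [absTrace, absTrace, add_right_cancel h]
  exact Finset.sum_congr rfl fun i _ => by rw [← pow_mul, pow_succ']

section Conj

variable {F : Type*} [Field F] [CharP F 2]

theorem bar_eq (m : ℕ) (x : F) : bar m x = iterateFrobenius F 2 m x := by
  rw [iterateFrobenius_def, bar]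

theorem bar_add (m : ℕ) (x y : F) : bar m (x + y) = bar m x + bar m y := by simp [bar_eq]

theorem bar_mul (m : ℕ) (x y : F) : bar m (x * y) = bar m x * bar m y := by simp [bar_eq]

theorem bar_div (m : ℕ) (x y : F) : bar m (x / y) = bar m x / bar m y := by simp [bar_eq]

theorem bar_one (m : ℕ) : bar m (1 : F) = 1 := by simp [bar_eq]

theorem bar_zero (m : ℕ) : bar m (0 : F) = 0 := by simp [bar_eq]

theorem bar_pow (m : ℕ) (x : F) (j : ℕ) : bar m (x ^ j) = bar m x ^ j := by simp [bar_eq]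

theorem bar_ne_zero {m : ℕ} {x : F} (hx : x ≠ 0) : bar m x ≠ 0 := by simpa [bar_eq] using hx

theorem add_pow_two_pow (x y : F) (j : ℕ) : (x + y) ^ 2 ^ j = x ^ 2 ^ j + y ^ 2 ^ j :=
  add_pow_char_pow x y 2 j

theorem absTrace_add (m : ℕ) (x y : F) : absTrace m (x + y) = absTrace m x + absTrace m y := by
  simp [absTrace, add_pow_two_pow, Finset.sum_add_distrib]

theorem absTrace_one {m : ℕ} (hm : Odd m) : absTrace m (1 : F) = 1 := by
  obtain ⟨j, rfl⟩ := hm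
  simp [absTrace, CharTwo.two_eq_zero]

theorem absTrace_pow_two' (m : ℕ) (x : F) : absTrace m (x ^ 2) = absTrace m x ^ 2 := by
  rw [absTrace, absTrace, ← frobenius_def 2 (∑ i ∈ _, _), map_sum]
  exact Finset.sum_congr rfl fun i _ => by rw [frobenius_def, ← pow_mul, ← pow_mul, mul_comm]

theorem absTrace_eq_zero_or_one {m : ℕ} {x : F} (hx : bar m x = x) :
    absTrace m x = 0 ∨ absTrace m x = 1 := by
  have h := (absTrace_pow_two' m x).symm.trans (absTrace_pow_two hx)
  have h' : absTrace m x * (absTrace m x - 1) = 0 := by linear_combination h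
  rcases mul_eq_zero.mp h' with h0 | h1
  · exact .inl h0
  · exact .inr (sub_eq_zero.mp h1)

theorem absTrace_pow_two_pow {m : ℕ} {x : F} (hx : bar m x = x) (j : ℕ) :
    absTrace m (x ^ 2 ^ j) = absTrace m x := by
  induction j with
  | zero => simp
  | succ j ih =>
    rw [pow_succ, pow_mul, absTrace_pow_two (by rw [bar_pow, hx]), ih]

/-- If `a ^ 2 + a = u` lies in the subfield, then `a + a ^ 2 ^ k` has absolute trace
`k * Tr u`. -/
theorem absTrace_add_pow {m k : ℕ} {a u : F} (hu : bar m u = u) (ha : a ^ 2 + a = u) :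
    absTrace m (a + a ^ 2 ^ k) = k * absTrace m u := by
  induction k with
  | zero => simp [CharTwo.add_self_eq_zero, absTrace_zero]
  | succ k ih =>
    have : a + a ^ 2 ^ (k + 1) = (a + a ^ 2 ^ k) + u ^ 2 ^ k := by
      rw [← ha, add_pow_two_pow, pow_succ', pow_mul]
      linear_combination -(a ^ 2 ^ k) * CharTwo.two_eq_zero (R := F)
    rw [this, absTrace_add, ih, absTrace_pow_two_pow hu]
    push_cast; ring

theorem eq_absTrace_of_sq_add_eq_zero {m : ℕ} (hm : Odd m) {x : F} (hx : x ^ 2 + x = 0) :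
    x = absTrace m x := by
  have h : x * (x + 1) = 0 := by linear_combination hx
  rcases mul_eq_zero.mp h with rfl | h
  · rw [absTrace_zero]
  · rw [show x = 1 from CharTwo.add_eq_zero.mp h, absTrace_one hm]

/-- The half trace solves `a ^ 2 + a = u + Tr u` inside the subfield. -/
theorem exists_halfTrace {m : ℕ} (hm : Odd m) {u : F} (hu : bar m u = u) :
    ∃ a : F, bar m a = a ∧ a ^ 2 + a = u + absTrace m u := by
  obtain ⟨j, rfl⟩ := hm
  -- With m = 2j + 1, squaring fills in the odd exponents, giving 2j + 2 = m + 1 terms: the trace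
  -- and one extra term u^(2^m) = u.
  refine ⟨∑ i ∈ Finset.range (j + 1), u ^ 2 ^ (2 * i), ?_, ?_⟩
  · rw [bar_eq, map_sum]
    exact Finset.sum_congr rfl fun i _ => by rw [← bar_eq, bar_pow, hu]
  · have key : ∀ l : ℕ, (∑ i ∈ Finset.range l, u ^ 2 ^ (2 * i)) ^ 2 +
        ∑ i ∈ Finset.range l, u ^ 2 ^ (2 * i) = absTrace (2 * l) u := by
      intro l
      induction l with
      | zero => simp [absTrace]
      | succ l ih =>
        rw [Finset.sum_range_succ, CharTwo.add_sq, mul_add_one, absTrace, Finset.sum_range_succ,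
          Finset.sum_range_succ, ← absTrace, ← ih, ← pow_mul, ← pow_succ]
        ring
    rw [key, mul_add_one, show 2 * j + 2 = (2 * j + 1) + 1 by ring, absTrace,
      Finset.sum_range_succ, ← absTrace, show u ^ 2 ^ (2 * j + 1) = u from hu, add_comm]

end Conj

/-! ### Fixed points of Frobenius powers, cube roots of unity and the subfield of order 2^m -/

section Frobenius

theorem pow_two_pow_gcd {F : Type*} [Field F] {x : F} {i j : ℕ} (hi : x ^ 2 ^ i = x)
    (hj : x ^ 2 ^ j = x) : x ^ 2 ^ Nat.gcd i j = x := by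
  have key : ∀ l : ℕ, (fun y : F => y ^ 2)^[l] x = x ^ 2 ^ l := fun l => by
    rw [pow_iterate]
  have h := Function.IsPeriodicPt.gcd (f := fun y : F => y ^ 2) (x := x) (m := i) (n := j)
    ((key i).trans hi) ((key j).trans hj)
  exact (key _).symm.trans h

/-- Since 3 divides 4^m - 1, a unit of order 3 exists; an odd number of squarings sends it to its
square ω² = ω + 1. -/
theorem exists_primitive_cube_root {F : Type*} [Field F] [Fintype F] {m : ℕ} (hm : Odd m)
    [CharP F 2] (hF : Fintype.card F = 2 ^ (2 * m)) :
    ∃ ω : F, ω ^ 2 + ω + 1 = 0 ∧ bar m ω = ω + 1 ∧ ∀ k, Odd k → ω ^ 2 ^ k = ω + 1 := by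
  classical
  have h2 := CharTwo.two_eq_zero (R := F)
  have hdvd : 3 ∣ Fintype.card Fˣ := by
    rw [Fintype.card_units, hF, pow_mul]
    simpa using Nat.sub_dvd_pow_sub_pow 4 1 m
  have : Fact (Nat.Prime 3) := ⟨Nat.prime_three⟩
  obtain ⟨w, hw⟩ := exists_prime_orderOf_dvd_card 3 hdvd
  have h3 : (w : F) ^ 3 = 1 := by
    have := pow_orderOf_eq_one w
    rw [hw] at this
    simpa using congrArg Units.val this
  have h1 : (w : F) - 1 ≠ 0 := fun h => by
    have : w = 1 := Units.ext (by simpa [sub_eq_zero] using h)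
    rw [this, orderOf_one] at hw
    omega
  have hω : (w : F) ^ 2 + w + 1 = 0 := by
    refine mul_left_cancel₀ h1 ?_
    linear_combination h3
  have hodd : ∀ k, Odd k → (w : F) ^ 2 ^ k = w + 1 := by
    rintro k ⟨j, rfl⟩
    have h4 : (w : F) ^ 2 ^ (2 * j) = w := by
      induction j with
      | zero => simp
      | succ j ih =>
        rw [mul_add_one, pow_add, pow_mul, ih]
        linear_combination (w : F) * h3
    rw [pow_succ, pow_mul, h4]
    linear_combination hω - (w + 1 : F) * h2
  exact ⟨w, hω, hodd m hm, hodd⟩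

/-- In the field with `2 ^ (2 * m)` elements, an element of the subfield of order `2 ^ m` is of the
form `a ^ 2 + a`, with `a` in the subfield exactly when its trace vanishes. -/
theorem exists_sq_add_eq {F : Type*} [Field F] [Fintype F] [CharP F 2] {m : ℕ} (hm : Odd m)
    (hF : Fintype.card F = 2 ^ (2 * m)) {u : F} (hu : bar m u = u) :
    ∃ a : F, a ^ 2 + a = u ∧ bar m a = a + absTrace m u := by
  have h2 := CharTwo.two_eq_zero (R := F)
  obtain ⟨a, ha, hau⟩ := exists_halfTrace hm hu
  rcases absTrace_eq_zero_or_one hu with h | h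
  · exact ⟨a, by rw [hau, h, add_zero], by rw [ha, h, add_zero]⟩
  · obtain ⟨ω, hω, hωm, -⟩ := exists_primitive_cube_root hm hF
    refine ⟨a + ω, ?_, by rw [bar_add, ha, hωm, h, add_assoc]⟩
    rw [h] at hau
    linear_combination hau + hω + (a * ω) * h2

/-- The subfield of order `2 ^ m` of the field with `2 ^ (2 * m)` elements. -/
def realSubfield (F : Type*) [Field F] [CharP F 2] (m : ℕ) : Subfield F :=
  (iterateFrobenius F 2 m).eqLocusField (RingHom.id F)

theorem mem_realSubfield {F : Type*} [Field F] [CharP F 2] {m : ℕ} {x : F} :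
    x ∈ realSubfield F m ↔ bar m x = x := by
  rw [bar_eq]; rfl

/-- The upper bound counts roots of X^(2^m) - X. For the lower bound, x ↦ x + x̄ has the subfield as
kernel and takes values in it, so |F| is at most the square of its order. -/
theorem card_realSubfield {F : Type*} [Field F] [Fintype F] [CharP F 2] {m : ℕ} (hm : m ≠ 0)
    (hF : Fintype.card F = 2 ^ (2 * m)) [Fintype (realSubfield F m)] :
    Fintype.card (realSubfield F m) = 2 ^ m := by
  classical
  have h2 := CharTwo.two_eq_zero (R := F)
  have hle : Fintype.card (realSubfield F m) ≤ 2 ^ m := by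
    rw [← Finset.card_univ, ← Finset.card_map (Function.Embedding.subtype _)]
    refine card_le_of_div_pow_eq one_ne_zero (Nat.one_lt_two_pow hm) fun x hx y hy => ?_
    simp only [Finset.mem_map, Finset.mem_univ, true_and, Function.Embedding.subtype_apply] at hx hy
    obtain ⟨x, rfl⟩ := hx
    obtain ⟨y, rfl⟩ := hy
    rw [div_one]
    exact mem_realSubfield.mp (sub_mem x.2 y.2)
  let T : F →+ realSubfield F m :=
    { toFun := fun x => ⟨x + bar m x, mem_realSubfield.mpr (by
        rw [bar_add, bar_bar hF, add_comm])⟩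
      map_zero' := by ext; simp [bar_zero]
      map_add' := fun x y => by ext; simp [bar_add]; ring }
  have hker : Nat.card T.ker = Fintype.card (realSubfield F m) := by
    rw [← Nat.card_eq_fintype_card]
    refine Nat.card_congr (Equiv.subtypeEquivRight fun x => ?_)
    rw [AddMonoidHom.mem_ker, mem_realSubfield, Subtype.ext_iff]
    change x + bar m x = 0 ↔ _
    rw [add_comm, CharTwo.add_eq_zero]
  have hcard : 2 ^ m * 2 ^ m ≤ Fintype.card (realSubfield F m) * Fintype.card (realSubfield F m) := by
    have h1 := AddSubgroup.card_eq_card_quotient_mul_card_addSubgroup T.ker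
    rw [Nat.card_congr (QuotientAddGroup.quotientKerEquivRange T).toEquiv, hker,
      Nat.card_eq_fintype_card, hF, two_mul, pow_add] at h1
    rw [h1]
    refine Nat.mul_le_mul_right _ ?_
    rw [← Nat.card_eq_fintype_card (α := realSubfield F m)]
    exact Nat.card_le_card_of_injective _ Subtype.val_injective
  exact le_antisymm hle (Nat.mul_self_le_mul_self_iff.mp hcard)

end Frobenius

/-! ### Simultaneous diagonalisation of a pencil of twisted bilinear forms -/

section Pencil

variable {F : Type*} [Field F] [CharP F 2]

/-- The value `U ᵀ M s` for `M = !![c 0, c 1; c 2, c 3]`. -/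
def twistedForm (c : Fin 4 → F) (U s : F × F) : F :=
  U.1 * (c 0 * s.1 + c 1 * s.2) + U.2 * (c 2 * s.1 + c 3 * s.2)

/-- If `(s, t)` are eigenvectors of `adj M * M'` and `(U, V)` are left eigenvectors of
`M' * adj M` with the same pair of distinct eigenvalues, then `M` is diagonal with respect to these
bases. -/
theorem twistedForm_diagonal {c d : Fin 4 → F} {U V s t : F × F} {l l' : F}
    (hs1 : (c 3 * d 0 + c 1 * d 2) * s.1 + (c 3 * d 1 + c 1 * d 3) * s.2 = l * s.1)
    (hs2 : (c 2 * d 0 + c 0 * d 2) * s.1 + (c 2 * d 1 + c 0 * d 3) * s.2 = l * s.2)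
    (ht1 : (c 3 * d 0 + c 1 * d 2) * t.1 + (c 3 * d 1 + c 1 * d 3) * t.2 = l' * t.1)
    (ht2 : (c 2 * d 0 + c 0 * d 2) * t.1 + (c 2 * d 1 + c 0 * d 3) * t.2 = l' * t.2)
    (hU1 : U.1 * (c 3 * d 0 + c 2 * d 1) + U.2 * (c 3 * d 2 + c 2 * d 3) = l * U.1)
    (hU2 : U.1 * (c 1 * d 0 + c 0 * d 1) + U.2 * (c 1 * d 2 + c 0 * d 3) = l * U.2)
    (hV1 : V.1 * (c 3 * d 0 + c 2 * d 1) + V.2 * (c 3 * d 2 + c 2 * d 3) = l' * V.1)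
    (hV2 : V.1 * (c 1 * d 0 + c 0 * d 1) + V.2 * (c 1 * d 2 + c 0 * d 3) = l' * V.2)
    (hl : l + l' ≠ 0) (hst : s.1 * t.2 + s.2 * t.1 ≠ 0) (hUV : U.1 * V.2 + U.2 * V.1 ≠ 0) :
    twistedForm c U t = 0 ∧ twistedForm c V s = 0 ∧
      twistedForm c U s * twistedForm d V t + twistedForm c V t * twistedForm d U s ≠ 0 := by
  have h2 := CharTwo.two_eq_zero (R := F)
  obtain ⟨g0, hg0⟩ : ∃ g, g = twistedForm c U s := ⟨_, rfl⟩
  obtain ⟨g1, hg1⟩ : ∃ g, g = twistedForm c U t := ⟨_, rfl⟩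
  obtain ⟨g2, hg2⟩ : ∃ g, g = twistedForm c V s := ⟨_, rfl⟩
  obtain ⟨g3, hg3⟩ : ∃ g, g = twistedForm c V t := ⟨_, rfl⟩
  obtain ⟨h0, hh0⟩ : ∃ g, g = twistedForm d U s := ⟨_, rfl⟩
  obtain ⟨h1, hh1⟩ : ∃ g, g = twistedForm d U t := ⟨_, rfl⟩
  obtain ⟨h2', hh2⟩ : ∃ g, g = twistedForm d V s := ⟨_, rfl⟩
  obtain ⟨h3, hh3⟩ : ∃ g, g = twistedForm d V t := ⟨_, rfl⟩
  -- Let G and H be the matrices of the two forms in the new bases. These identities compute entries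
  -- of adj G · H and H · adj G. Both sides are used because G may be singular.
  have e31 : g3 * h1 + g1 * h3 = 0 := by
    rw [hg1, hg3, hh1, hh3]; simp only [twistedForm]
    linear_combination (norm := (ring_nf; simp only [h2, mul_zero, add_zero]))
      (U.1 * V.2 + U.2 * V.1) * (t.2 * ht1 + t.1 * ht2)
  have e02 : g0 * h2' + g2 * h0 = 0 := by
    rw [hg0, hg2, hh0, hh2]; simp only [twistedForm]
    linear_combination (norm := (ring_nf; simp only [h2, mul_zero, add_zero]))
      (U.1 * V.2 + U.2 * V.1) * (s.2 * hs1 + s.1 * hs2)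
  have e30 : g3 * h0 + g1 * h2' = (U.1 * V.2 + U.2 * V.1) * (s.1 * t.2 + s.2 * t.1) * l := by
    rw [hg1, hg3, hh0, hh2]; simp only [twistedForm]
    linear_combination (norm := (ring_nf; simp only [h2, mul_zero, add_zero]))
      (U.1 * V.2 + U.2 * V.1) * (t.2 * hs1 + t.1 * hs2)
  have e03 : g0 * h3 + g2 * h1 = (U.1 * V.2 + U.2 * V.1) * (s.1 * t.2 + s.2 * t.1) * l' := by
    rw [hg0, hg2, hh1, hh3]; simp only [twistedForm]
    linear_combination (norm := (ring_nf; simp only [h2, mul_zero, add_zero]))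
      (U.1 * V.2 + U.2 * V.1) * (s.2 * ht1 + s.1 * ht2)
  have e01 : g0 * h1 + g1 * h0 = 0 := by
    rw [hg0, hg1, hh0, hh1]; simp only [twistedForm]
    linear_combination (norm := (ring_nf; simp only [h2, mul_zero, add_zero]))
      (s.1 * t.2 + s.2 * t.1) * (U.2 * hU1 + U.1 * hU2)
  have e23 : g2 * h3 + g3 * h2' = 0 := by
    rw [hg2, hg3, hh2, hh3]; simp only [twistedForm]
    linear_combination (norm := (ring_nf; simp only [h2, mul_zero, add_zero]))
      (s.1 * t.2 + s.2 * t.1) * (V.2 * hV1 + V.1 * hV2)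
  have e12 : g3 * h0 + g2 * h1 = (U.1 * V.2 + U.2 * V.1) * (s.1 * t.2 + s.2 * t.1) * l := by
    rw [hg2, hg3, hh0, hh1]; simp only [twistedForm]
    linear_combination (norm := (ring_nf; simp only [h2, mul_zero, add_zero]))
      (s.1 * t.2 + s.2 * t.1) * (V.2 * hU1 + V.1 * hU2)
  have hne : (U.1 * V.2 + U.2 * V.1) * (s.1 * t.2 + s.2 * t.1) * (l + l') ≠ 0 :=
    mul_ne_zero (mul_ne_zero hUV hst) hl
  have e12' : g1 * h2' + g2 * h1 = 0 := by
    linear_combination e30 + e12 +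
      ((U.1 * V.2 + U.2 * V.1) * (s.1 * t.2 + s.2 * t.1) * l - g3 * h0) * h2
  have ht : g0 * h3 + g3 * h0 + (g1 * h2' + g2 * h1) =
      (U.1 * V.2 + U.2 * V.1) * (s.1 * t.2 + s.2 * t.1) * (l + l') := by
    linear_combination e30 + e03
  -- Multiplying the trace of adj G · H, which is nonzero in characteristic two because the
  -- eigenvalues differ, by an off-diagonal entry of G gives zero.
  have hz1 : g1 = 0 := by
    by_contra h
    refine hne ?_
    rw [← ht]
    refine mul_left_cancel₀ h ?_
    linear_combination g0 * e31 + g3 * e01 + g1 * e12' - g0 * g3 * h1 * h2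
  have hz2 : g2 = 0 := by
    by_contra h
    refine hne ?_
    rw [← ht]
    refine mul_left_cancel₀ h ?_
    linear_combination g0 * e23 + g3 * e02 + g2 * e12' - g0 * g3 * h2' * h2
  rw [← hg0, ← hg1, ← hg2, ← hg3, ← hh3, ← hh0]
  refine ⟨hz1, hz2, ?_⟩
  rw [hz1, hz2] at ht
  have : g0 * h3 + g3 * h0 = (U.1 * V.2 + U.2 * V.1) * (s.1 * t.2 + s.2 * t.1) * (l + l') := by
    linear_combination ht
  rwa [this]

end Pencil

/-! ### Parametrisation of `Γ` -/

theorem quad_eq_twistedForm {F : Type*} [Field F] {m k : ℕ} (c : Fin 4 → F) (x : F) :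
    quad m k c x = twistedForm c (bar m x ^ 2 ^ k, x ^ 2 ^ k) (bar m x, x) := by
  simp only [quad, twistedForm, pow_succ]
  ring

/-- Conjugation swaps the coordinates of (x̄, x), so the conjugate form has the conjugated matrix
with rows and columns reversed. -/
theorem bar_twistedForm {F : Type*} [Field F] [CharP F 2] {m : ℕ} (c : Fin 4 → F) (U s : F × F) :
    bar m (twistedForm c U s) =
      twistedForm ![bar m (c 3), bar m (c 2), bar m (c 1), bar m (c 0)]
        (bar m U.2, bar m U.1) (bar m s.2, bar m s.1) := by
  simp [twistedForm, bar_add, bar_mul]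
  ring

section Gamma

variable {F : Type*} [Field F] [CharP F 2] [Fintype F] {m k : ℕ}

/-- A determinant identity makes τ = θ₄/θ₁ satisfy τ² + τ = θθ̄ + (θθ̄)^(2^k). So τ + a + a^(2^k) is
0 or 1, and the trace condition decides which. -/
theorem Gam_exists_halfTrace (hm : Odd m) (hk : Odd k) (hF : Fintype.card F = 2 ^ (2 * m))
    {c : Fin 4 → F} (hc : c ∈ Gam F m k) :
    ∃ θ a : F, bar m (theta1 m c) = theta1 m c ∧ theta2 m c = θ * theta1 m c ∧
      bar m (theta2 m c) = bar m θ * theta1 m c ∧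
      theta3 m c = bar m θ ^ 2 ^ k * theta1 m c ∧
      bar m (theta3 m c) = θ ^ 2 ^ k * theta1 m c ∧
      a ^ 2 + a = θ * bar m θ ∧ bar m a = a + absTrace m (θ * bar m θ) ∧
      (a ^ 2 ^ k) ^ 2 + a ^ 2 ^ k = θ ^ 2 ^ k * bar m θ ^ 2 ^ k ∧
      theta4 m c = (1 + absTrace m (θ * bar m θ) + a + a ^ 2 ^ k) * theta1 m c ∧
      theta2 m c * bar m (theta2 m c) / theta1 m c ^ 2 = θ * bar m θ := by
  have h2 := CharTwo.two_eq_zero (R := F)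
  obtain ⟨h1, htr, hcomp⟩ := hc
  have hb1 : bar m (theta1 m c) = theta1 m c := by
    simp only [theta1, bar_add, bar_mul, bar_bar hF]; ring
  obtain ⟨θ, hθ⟩ : ∃ θ, θ = theta2 m c / theta1 m c := ⟨_, rfl⟩
  obtain ⟨τ, hτ⟩ : ∃ τ, τ = theta4 m c / theta1 m c := ⟨_, rfl⟩
  have e2 : theta2 m c = θ * theta1 m c := by rw [hθ]; field_simp
  have e2' : bar m (theta2 m c) = bar m θ * theta1 m c := by rw [e2, bar_mul, hb1]
  have e3' : bar m (theta3 m c) = θ ^ 2 ^ k * theta1 m c := by rw [hθ, hcomp]; field_simp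
  have e3 : theta3 m c = bar m θ ^ 2 ^ k * theta1 m c := by
    rw [← bar_bar hF (theta3 m c), e3', bar_mul, bar_pow, hb1]
  have e4 : theta4 m c = τ * theta1 m c := by rw [hτ]; field_simp
  have hu : bar m (θ * bar m θ) = θ * bar m θ := by rw [bar_mul, bar_bar hF, mul_comm]
  obtain ⟨a, ha, hba⟩ := exists_sq_add_eq hm hF hu
  have ha' : (a ^ 2 ^ k) ^ 2 + a ^ 2 ^ k = θ ^ 2 ^ k * bar m θ ^ 2 ^ k := by
    rw [← mul_pow, ← ha, add_pow_two_pow, ← pow_mul, ← pow_mul, mul_comm]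
  have hdet : theta4 m c * (theta4 m c + theta1 m c) =
      theta2 m c * bar m (theta2 m c) + theta3 m c * bar m (theta3 m c) := by
    simp only [theta1, theta2, theta3, theta4, bar_add, bar_mul, bar_bar hF]
    linear_combination (c 1 ^ 2 * bar m (c 1) ^ 2 + c 2 ^ 2 * bar m (c 2) ^ 2 +
      2 * c 1 * bar m (c 1) * c 2 * bar m (c 2) - c 1 * c 2 * bar m (c 0) * bar m (c 3) -
      bar m (c 1) * bar m (c 2) * c 0 * c 3) * h2
  have hτ2 : τ ^ 2 + τ = θ * bar m θ + θ ^ 2 ^ k * bar m θ ^ 2 ^ k := by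
    rw [e4, e2', e3', e2, e3] at hdet
    refine mul_right_cancel₀ (pow_ne_zero 2 h1) ?_
    linear_combination hdet
  -- An element of {0, 1} equals its own trace because `m` is odd; oddness of `k` turns the factor
  -- `k` into 1.
  have hsum : τ + (a + a ^ 2 ^ k) = 1 + absTrace m (θ * bar m θ) := by
    rw [eq_absTrace_of_sq_add_eq_zero hm (x := τ + (a + a ^ 2 ^ k)), absTrace_add, hτ, htr,
      absTrace_add_pow hu ha]
    · obtain ⟨j, rfl⟩ := hk
      push_cast
      linear_combination j * absTrace m (θ * bar m θ) * h2
    · linear_combination hτ2 + ha + ha' +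
        (τ * a + τ * a ^ 2 ^ k + a * a ^ 2 ^ k + θ * bar m θ + θ ^ 2 ^ k * bar m θ ^ 2 ^ k) * h2
  refine ⟨θ, a, hb1, e2, e2', e3, e3', ha, hba, ha', ?_, ?_⟩
  · rw [e4]
    congr 1
    linear_combination hsum - (a + a ^ 2 ^ k) * h2
  · rw [e2', e2]; field_simp

theorem Gam_trace_eq (hF : Fintype.card F = 2 ^ (2 * m)) (c : Fin 4 → F) :
    absTrace m (theta2 m c * bar m (theta2 m c) / theta1 m c ^ 2) = 0 ∨
      absTrace m (theta2 m c * bar m (theta2 m c) / theta1 m c ^ 2) = 1 := by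
  refine absTrace_eq_zero_or_one ?_
  have hb1 : bar m (theta1 m c) = theta1 m c := by
    simp only [theta1, bar_add, bar_mul, bar_bar hF]; ring
  rw [bar_div, bar_mul, bar_bar hF, bar_pow, hb1, mul_comm]

/-- `x ↦ u * x + v * x̄` is invertible when `u * ū ≠ v * v̄`. -/
theorem exists_semilinear_equiv (hF : Fintype.card F = 2 ^ (2 * m)) {u v : F}
    (h : u * bar m u + v * bar m v ≠ 0) : ∃ L : F ≃+ F, ∀ x, L x = u * x + v * bar m x := by
  have h2 := CharTwo.two_eq_zero (R := F)
  let T : F →+ F :=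
    { toFun := fun x => u * x + v * bar m x
      map_zero' := by simp [bar_zero]
      map_add' := fun x y => by rw [bar_add]; ring }
  have hinj : Function.Injective T := by
    refine (injective_iff_map_eq_zero T).mpr fun x hx => ?_
    have hx1 : u * x + v * bar m x = 0 := hx
    have hx2 : bar m u * bar m x + bar m v * x = 0 := by
      have := congrArg (bar m) hx1
      simpa [bar_add, bar_mul, bar_bar hF, bar_zero] using this
    refine (mul_eq_zero.mp ?_).resolve_left h
    linear_combination bar m u * hx1 + v * hx2 - (bar m u * v * bar m x) * h2
  exact ⟨AddEquiv.ofBijective T (Finite.injective_iff_bijective.mp hinj), fun _ => rfl⟩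

/-- A pair of elements independent over the subfield of order `2 ^ m` gives coordinates. -/
theorem exists_coordinates (hm : m ≠ 0) (hF : Fintype.card F = 2 ^ (2 * m)) {p r : F}
    (h : p * bar m r + r * bar m p ≠ 0) :
    ∃ L : realSubfield F m × realSubfield F m ≃+ F, ∀ x, L x = p * x.1 + r * x.2 := by
  classical
  have h2 := CharTwo.two_eq_zero (R := F)
  let T : realSubfield F m × realSubfield F m →+ F :=
    { toFun := fun x => p * x.1 + r * x.2
      map_zero' := by simp
      map_add' := fun x y => by simp; ring }
  have hinj : Function.Injective T := by
    refine (injective_iff_map_eq_zero T).mpr fun x hx => ?_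
    have hx0 : p * x.1 + r * x.2 = 0 := hx
    have hx1 := mem_realSubfield.mp x.1.2
    have hx2 := mem_realSubfield.mp x.2.2
    have hx3 : bar m p * x.1 + bar m r * x.2 = 0 := by
      have := congrArg (bar m) hx0
      simpa [bar_add, bar_mul, hx1, hx2, bar_zero] using this
    have h1 : (x.1 : F) = 0 := by
      refine (mul_eq_zero.mp ?_).resolve_left h
      linear_combination bar m r * hx0 + r * hx3 - (r * bar m r * x.2) * h2
    have h3 : (x.2 : F) = 0 := by
      refine (mul_eq_zero.mp ?_).resolve_left h
      linear_combination bar m p * hx0 + p * hx3 - (p * bar m p * x.1) * h2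
    exact Prod.ext (Subtype.ext h1) (Subtype.ext h3)
  refine ⟨AddEquiv.ofBijective T ((Fintype.bijective_iff_injective_and_card T).mpr ⟨hinj, ?_⟩),
    fun _ => rfl⟩
  rw [Fintype.card_prod, card_realSubfield hm hF, hF, ← pow_add, two_mul]

/-- An explicit Hilbert 90 for a/θ, which has norm one: p = a + θ̄ works unless it vanishes, and
then p = a does. -/
theorem exists_mul_eq_mul_bar (hF : Fintype.card F = 2 ^ (2 * m)) {a θ : F} (hθ : θ ≠ 0)
    (ha : a * bar m a = θ * bar m θ) (ha0 : a + bar m a = 1) :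
    ∃ p ≠ 0, θ * p = a * bar m p := by
  have h2 := CharTwo.two_eq_zero (R := F)
  have ha0' : a ≠ 0 := by
    rintro rfl
    exact mul_ne_zero hθ (bar_ne_zero hθ) (by rw [← ha, zero_mul])
  by_cases h : a + bar m θ = 0
  · refine ⟨a, ha0', ?_⟩
    have h' : bar m a + θ = 0 := by
      have := congrArg (bar m) h
      simpa [bar_add, bar_bar hF, bar_zero] using this
    linear_combination a * h' - a * bar m a * h2
  · refine ⟨a + bar m θ, h, ?_⟩
    rw [bar_add, bar_bar hF]
    linear_combination -ha

/-- The entries of `adj M * M'` and `M' * adj M` for a member of `Γ`. -/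
theorem theta_entries (hF : Fintype.card F = 2 ^ (2 * m)) {c : Fin 4 → F}
    {t θ θ' s s' a b κ : F} (h1 : theta1 m c = t) (h2 : theta2 m c = θ * t)
    (h2' : bar m (theta2 m c) = θ' * t) (h3 : theta3 m c = s' * t)
    (h3' : bar m (theta3 m c) = s * t) (h4 : theta4 m c = (a + b) * t)
    (hκ : κ = c 1 * bar m (c 1) + c 3 * bar m (c 3) + a * t) :
    c 3 * bar m (c 3) + c 1 * bar m (c 1) = κ + a * t ∧
    c 3 * bar m (c 2) + c 1 * bar m (c 0) = θ * t ∧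
    c 2 * bar m (c 3) + c 0 * bar m (c 1) = θ' * t ∧
    c 2 * bar m (c 2) + c 0 * bar m (c 0) = κ + a * t + t ∧
    c 3 * bar m (c 3) + c 2 * bar m (c 2) = κ + b * t ∧
    c 3 * bar m (c 1) + c 2 * bar m (c 0) = s * t ∧
    c 1 * bar m (c 3) + c 0 * bar m (c 2) = s' * t ∧
    c 1 * bar m (c 1) + c 0 * bar m (c 0) = κ + b * t + t := by
  have h0 := CharTwo.two_eq_zero (R := F)
  simp only [theta1, theta2, theta3, theta4, bar_add, bar_mul, bar_bar hF] at h1 h2 h2' h3 h3' h4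
  refine ⟨?_, ?_, ?_, ?_, ?_, ?_, ?_, ?_⟩
  · linear_combination -hκ - a * t * h0
  · linear_combination h2
  · linear_combination h2'
  · linear_combination h1 - hκ - (c 1 * bar m (c 1) + c 3 * bar m (c 3) + a * t) * h0
  · linear_combination h4 - hκ - (c 1 * bar m (c 1)) * h0
  · linear_combination h3'
  · linear_combination h3
  · linear_combination h1 - hκ + h4 - (c 1 * bar m (c 1) + c 3 * bar m (c 3) + c 2 * bar m (c 2)) * h0

/-- Each member of `Γ₀` is linearly equivalent to `z ↦ z ^ (2 ^ (m + k) + 1)`. -/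
theorem GamPart_zero_equiv (hm : Odd m) (hk : Odd k) (hF : Fintype.card F = 2 ^ (2 * m))
    {c : Fin 4 → F} (hc : c ∈ GamPart F m k 0) :
    ∃ N L : F ≃+ F, ∀ x,
      quad m k c x = L (iterateFrobenius F 2 (m + k) (N x) * N x) := by
  have h2 := CharTwo.two_eq_zero (R := F)
  have h1 := hc.1.1
  obtain ⟨θ, a, -, e2, e2', e3, e3', ha, hba, hak, e4, hu⟩ := Gam_exists_halfTrace hm hk hF hc.1
  rw [← hu, hc.2, add_zero] at hba
  rw [← hu, hc.2, add_zero] at e4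
  -- The eigenvectors (a, θ̄) and (θ, a) have determinant `a`, so the root `a = 0` is replaced by
  -- the other root 1.
  obtain ⟨a, ha0, ha, hba, hak, e4⟩ : ∃ a ≠ 0, a ^ 2 + a = θ * bar m θ ∧ bar m a = a ∧
      (a ^ 2 ^ k) ^ 2 + a ^ 2 ^ k = θ ^ 2 ^ k * bar m θ ^ 2 ^ k ∧
      theta4 m c = (1 + a + a ^ 2 ^ k) * theta1 m c := by
    rcases eq_or_ne a 0 with h0 | h0
    · rw [h0] at ha hba hak e4
      refine ⟨1, one_ne_zero, ?_, bar_one m, ?_, ?_⟩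
      · linear_combination ha + h2
      · rw [one_pow, one_pow, one_add_one_eq_two, h2, ← hak]
        simp
      · rw [e4]
        simp only [one_pow, zero_pow (pow_ne_zero k two_ne_zero)]
        linear_combination -theta1 m c * h2
    · exact ⟨a, h0, ha, hba, hak, e4⟩
  obtain ⟨e, he⟩ : ∃ e, e = a ^ 2 ^ k := ⟨_, rfl⟩
  obtain ⟨s, hs⟩ : ∃ s, s = θ ^ 2 ^ k := ⟨_, rfl⟩
  obtain ⟨s', hs'⟩ : ∃ s', s' = bar m θ ^ 2 ^ k := ⟨_, rfl⟩
  obtain ⟨θ', hθ'⟩ : ∃ θ', θ' = bar m θ := ⟨_, rfl⟩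
  obtain ⟨t, ht⟩ : ∃ t, theta1 m c = t := ⟨_, rfl⟩
  obtain ⟨κ, hκ⟩ : ∃ κ, κ = c 1 * bar m (c 1) + c 3 * bar m (c 3) + a * t := ⟨_, rfl⟩
  have he0 : e ≠ 0 := he ▸ pow_ne_zero _ ha0
  rw [← he, ← hs, ← hs'] at hak
  rw [← he, ht, show 1 + a + e = a + (1 + e) by ring] at e4
  rw [← hs', ht] at e3
  rw [← hs, ht] at e3'
  rw [ht] at e2 h1
  rw [← hθ'] at ha
  rw [← hθ', ht] at e2'
  obtain ⟨A11, A12, A21, A22, B11, B21, B12, B22⟩ :=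
    theta_entries hF ht e2 e2' e3 e3' e4 hκ
  -- The left vector (s, e), the twist of (θ, a), is paired with (a, θ̄). This crossing yields the
  -- mixed monomial z̄^(2^k) z and its conjugate.
  obtain ⟨z1, z2, hne⟩ := twistedForm_diagonal (c := c)
    (d := ![bar m (c 3), bar m (c 2), bar m (c 1), bar m (c 0)])
    (U := (s, e)) (V := (e, s')) (s := (a, θ')) (t := (θ, a))
    (l := κ + t) (l' := κ)
    (by simp only [Matrix.cons_val]
        linear_combination a * A11 + θ' * A12 + t * ha + (θ * θ' * t - t * a) * h2)
    (by simp only [Matrix.cons_val]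
        linear_combination a * A21 + θ' * A22 + a * θ' * t * h2)
    (by simp only [Matrix.cons_val]
        linear_combination θ * A11 + a * A12 + a * θ * t * h2)
    (by simp only [Matrix.cons_val]
        linear_combination θ * A21 + a * A22 + t * ha + θ * θ' * t * h2)
    (by simp only [Matrix.cons_val]
        linear_combination s * B11 + e * B21 + e * s * t * h2)
    (by simp only [Matrix.cons_val]
        linear_combination s * B12 + e * B22 + t * hak + s * s' * t * h2)
    (by simp only [Matrix.cons_val]
        linear_combination e * B11 + s' * B21 + t * hak + s * s' * t * h2)
    (by simp only [Matrix.cons_val]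
        linear_combination e * B12 + s' * B22 + (e * s' + s') * t * h2)
    (by rwa [show κ + t + κ = t by linear_combination κ * h2])
    (by simp only; rwa [show a * a + θ' * θ = a by linear_combination ha + (θ * θ' - a) * h2])
    (by simp only; rwa [show s * s' + e * e = e by linear_combination hak + (s * s' - e) * h2])
  have hbθ : bar m θ' = θ := by rw [hθ', bar_bar hF]
  have hbe : bar m e = e := by rw [he, bar_pow, hba]
  have hbs : bar m s = s' := by rw [hs, hs', bar_pow]
  have hbs' : bar m s' = s := by rw [← hbs, bar_bar hF]
  obtain ⟨P, hP⟩ := exists_semilinear_equiv hF (u := a) (v := θ') (by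
    rwa [hba, hbθ, show a * a + θ' * θ = a by linear_combination ha + (θ * θ' - a) * h2])
  obtain ⟨L, hL⟩ := exists_semilinear_equiv hF (u := twistedForm c (e, s') (θ, a))
    (v := twistedForm c (s, e) (a, θ')) (by
      simp only [bar_twistedForm, hba, hbe, hbs, hbs', hbθ, ← hθ']
      rwa [add_comm])
  refine ⟨P.symm, L, fun x => ?_⟩
  obtain ⟨z, rfl⟩ := P.surjective x
  have hz : iterateFrobenius F 2 (m + k) z = bar m z ^ 2 ^ k := by
    rw [iterateFrobenius_def, bar, ← pow_mul, ← pow_add]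
  have hbz : bar m (bar m z ^ 2 ^ k) = z ^ 2 ^ k := by rw [bar_pow, bar_bar hF]
  have hx : bar m (a * z + θ' * bar m z) = a * bar m z + θ * z := by
    rw [bar_add, bar_mul, bar_mul, bar_bar hF, hba, hbθ]
  have hxk : (a * z + θ' * bar m z) ^ 2 ^ k = e * z ^ 2 ^ k + s' * bar m z ^ 2 ^ k := by
    rw [add_pow_two_pow, mul_pow, mul_pow, he, hs', hθ']
  have hxk' : (a * bar m z + θ * z) ^ 2 ^ k = e * bar m z ^ 2 ^ k + s * z ^ 2 ^ k := by
    rw [add_pow_two_pow, mul_pow, mul_pow, he, hs]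
  rw [AddEquiv.symm_apply_apply, quad_eq_twistedForm, hP, hL, bar_mul, hz, hbz, hx, hxk, hxk']
  simp only [twistedForm] at z1 z2 ⊢
  linear_combination z ^ 2 ^ k * z * z1 + bar m z ^ 2 ^ k * bar m z * z2

/-- Each member of `Γ₁` is linearly equivalent to `(X, Y) ↦ (X ^ (2 ^ k + 1), Y ^ (2 ^ k + 1))`
on pairs of elements of the subfield of order `2 ^ m`. -/
theorem GamPart_one_equiv (hm : Odd m) (hk : Odd k) (hF : Fintype.card F = 2 ^ (2 * m))
    {c : Fin 4 → F} (hc : c ∈ GamPart F m k 1) :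
    ∃ (N : F ≃+ realSubfield F m × realSubfield F m) (L : realSubfield F m × realSubfield F m ≃+ F),
      ∀ x, quad m k c x =
        L (Prod.map (fun y => iterateFrobenius (realSubfield F m) 2 k y * y)
          (fun y => iterateFrobenius (realSubfield F m) 2 k y * y) (N x)) := by
  have h2 := CharTwo.two_eq_zero (R := F)
  have h1 := hc.1.1
  obtain ⟨θ, a, -, e2, e2', e3, e3', ha, hba, hak, e4, hu⟩ := Gam_exists_halfTrace hm hk hF hc.1
  rw [← hu, hc.2] at hba
  rw [← hu, hc.2, one_add_one_eq_two, h2, zero_add] at e4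
  have hθ0 : θ ≠ 0 := by
    rintro rfl
    have : absTrace m (0 * bar m (0 : F)) = 1 := by rw [← hu, hc.2]
    rw [zero_mul, absTrace_zero] at this
    exact zero_ne_one this
  -- Here ā = a + 1, so both roots `a` and `a + 1` have norm a² + a = θθ̄. The resulting
  -- eigenvectors (p̄, p) and (r̄, r) are self-conjugate.
  obtain ⟨p, hp0, hp⟩ := exists_mul_eq_mul_bar hF (a := a) hθ0
    (by rw [hba, ← ha]; ring) (by rw [hba]; linear_combination a * h2)
  obtain ⟨r, hr0, hr⟩ := exists_mul_eq_mul_bar hF (a := a + 1) hθ0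
    (by rw [bar_add, bar_one, hba, ← ha]; linear_combination (a + 1) * h2)
    (by rw [bar_add, bar_one, hba]; linear_combination (a + 1) * h2)
  have hp' : bar m θ * bar m p = (a + 1) * p := by
    rw [← bar_mul, hp, bar_mul, bar_bar hF, hba]
  have hr' : bar m θ * bar m r = a * r := by
    rw [← bar_mul, hr, bar_mul, bar_bar hF, bar_add, bar_one, hba]
    linear_combination r * h2
  have hpr : bar m p * r + p * bar m r ≠ 0 := by
    intro h
    refine mul_ne_zero (bar_ne_zero (m := m) hp0) (bar_ne_zero (m := m) hr0) ?_
    linear_combination θ * h - bar m p * hr - bar m r * hp - a * bar m p * bar m r * h2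
  have hfr : ∀ {x y z w : F}, x * y = z * w → x ^ 2 ^ k * y ^ 2 ^ k = z ^ 2 ^ k * w ^ 2 ^ k :=
    fun h => by rw [← mul_pow, h, mul_pow]
  have hP := hfr hp
  have hP' := hfr hp'
  have hR := hfr hr
  have hR' := hfr hr'
  rw [add_pow_two_pow, one_pow] at hP' hR
  have hPR : bar m p ^ 2 ^ k * r ^ 2 ^ k + p ^ 2 ^ k * bar m r ^ 2 ^ k ≠ 0 := by
    rw [← mul_pow, ← mul_pow, ← add_pow_two_pow]
    exact pow_ne_zero _ hpr
  obtain ⟨t, ht⟩ : ∃ t, theta1 m c = t := ⟨_, rfl⟩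
  rw [ht] at e2 e2' e3 e3' e4 h1
  obtain ⟨κ, hκ⟩ : ∃ κ, κ = c 1 * bar m (c 1) + c 3 * bar m (c 3) + a * t := ⟨_, rfl⟩
  obtain ⟨A11, A12, A21, A22, B11, B21, B12, B22⟩ :=
    theta_entries hF ht e2 e2' e3 e3' e4 hκ
  obtain ⟨z1, z2, hne⟩ := twistedForm_diagonal (c := c)
    (d := ![bar m (c 3), bar m (c 2), bar m (c 1), bar m (c 0)])
    (U := (bar m p ^ 2 ^ k, p ^ 2 ^ k)) (V := (bar m r ^ 2 ^ k, r ^ 2 ^ k))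
    (s := (bar m p, p)) (t := (bar m r, r)) (l := κ) (l' := κ + t)
    (by simp only [Matrix.cons_val]
        linear_combination bar m p * A11 + p * A12 + t * hp + a * bar m p * t * h2)
    (by simp only [Matrix.cons_val]
        linear_combination bar m p * A21 + p * A22 + t * hp' + (a + 1) * p * t * h2)
    (by simp only [Matrix.cons_val]
        linear_combination bar m r * A11 + r * A12 + t * hr + a * bar m r * t * h2)
    (by simp only [Matrix.cons_val]
        linear_combination bar m r * A21 + r * A22 + t * hr' + a * r * t * h2)
    (by simp only [Matrix.cons_val]
        linear_combination bar m p ^ 2 ^ k * B11 + p ^ 2 ^ k * B21 + t * hP +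
          a ^ 2 ^ k * bar m p ^ 2 ^ k * t * h2)
    (by simp only [Matrix.cons_val]
        linear_combination bar m p ^ 2 ^ k * B12 + p ^ 2 ^ k * B22 + t * hP' +
          (a ^ 2 ^ k + 1) * p ^ 2 ^ k * t * h2)
    (by simp only [Matrix.cons_val]
        linear_combination bar m r ^ 2 ^ k * B11 + r ^ 2 ^ k * B21 + t * hR +
          a ^ 2 ^ k * bar m r ^ 2 ^ k * t * h2)
    (by simp only [Matrix.cons_val]
        linear_combination bar m r ^ 2 ^ k * B12 + r ^ 2 ^ k * B22 + t * hR' +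
          a ^ 2 ^ k * r ^ 2 ^ k * t * h2)
    (by rwa [show κ + (κ + t) = t by linear_combination κ * h2])
    hpr hPR
  obtain ⟨P, hPdef⟩ := exists_coordinates hm.pos.ne' hF (p := p) (r := r) (by
    rwa [show p * bar m r + r * bar m p = bar m p * r + p * bar m r by ring])
  obtain ⟨L, hL⟩ := exists_coordinates hm.pos.ne' hF
    (p := twistedForm c (bar m p ^ 2 ^ k, p ^ 2 ^ k) (bar m p, p))
    (r := twistedForm c (bar m r ^ 2 ^ k, r ^ 2 ^ k) (bar m r, r)) (by
      simpa only [bar_twistedForm, bar_pow, bar_bar hF] using hne)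
  refine ⟨P.symm, L, fun x => ?_⟩
  obtain ⟨⟨X, Y⟩, rfl⟩ := P.surjective x
  have hX : bar m (X : F) = X := mem_realSubfield.mp X.2
  have hY : bar m (Y : F) = Y := mem_realSubfield.mp Y.2
  have hx : bar m (p * (X : F) + r * Y) = bar m p * X + bar m r * Y := by
    rw [bar_add, bar_mul, bar_mul, hX, hY]
  rw [AddEquiv.symm_apply_apply, quad_eq_twistedForm, hPdef, hL, hx, add_pow_two_pow,
    add_pow_two_pow, mul_pow, mul_pow, mul_pow, mul_pow]
  simp only [Prod.map, iterateFrobenius_def, Subfield.coe_mul, SubmonoidClass.coe_pow]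
  simp only [twistedForm] at z1 z2 ⊢
  linear_combination (X : F) ^ 2 ^ k * Y * z1 + (Y : F) ^ 2 ^ k * X * z2

end Gamma

/-! ### Permutations and uniformities -/

section Uniformity

theorem gold_injective {F : Type*} [Field F] [CharP F 2] (σ : F →+* F)
    (h : ∀ y, σ (σ y) = y → σ y = y) : Function.Injective fun x => σ x * x := by
  have h2 := CharTwo.two_eq_zero (R := F)
  intro x y hxy
  simp only at hxy
  rcases eq_or_ne y 0 with rfl | hy
  · simpa using hxy
  have hy' : σ y ≠ 0 := by simpa using hy
  obtain ⟨z, hz⟩ : ∃ z, z = x / y := ⟨_, rfl⟩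
  have h1 : σ z * z = 1 := by
    rw [hz, map_div₀]; field_simp; exact hxy
  have h3 : σ (σ z) * σ z = 1 := by rw [← map_mul, h1, map_one]
  have h4 : σ (σ z) = z := by linear_combination z * h3 - σ (σ z) * h1
  rw [h z h4] at h1
  have h5 : (z + 1) ^ 2 = 0 := by linear_combination h1 + (z + 1) * h2
  have h6 : z = 1 := CharTwo.add_eq_zero.mp (pow_eq_zero_iff two_ne_zero |>.mp h5)
  rwa [hz, div_eq_one_iff_eq hy] at h6

/-- Writing m + k = 2h, the number h is prime to m. It follows that the Frobenius power 2^(m+k) and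
its square have the same fixed points in F, namely those with y⁴ = y. -/
theorem gcd_add_two_mul {m k : ℕ} (hm : Odd m) (hk : Odd k) (hmk : Nat.gcd m k = 1) :
    Nat.gcd (m + k) (2 * m) = 2 ∧ Nat.gcd (2 * (m + k)) (2 * m) = 2 := by
  have h1 : Nat.gcd (m + k) m = 1 :=
    Nat.coprime_self_add_left.mpr (Nat.Coprime.symm hmk)
  obtain ⟨h, hh⟩ := hm.add_odd hk
  have h3 : Nat.gcd h m = 1 :=
    Nat.Coprime.coprime_dvd_left (⟨2, by rw [hh]; ring⟩)
      h1
  refine ⟨?_, by rw [Nat.gcd_mul_left, h1, mul_one]⟩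
  rw [hh, ← two_mul, Nat.gcd_mul_left, h3, mul_one]

theorem pow_two_pow_eq_of_pow_four {F : Type*} [Field F] {y : F} (hy : y ^ 4 = y) {j : ℕ}
    (hj : Even j) : y ^ 2 ^ j = y := by
  obtain ⟨i, rfl⟩ := hj
  induction i with
  | zero => simp
  | succ i ih =>
    rw [show i + 1 + (i + 1) = i + i + 2 by ring, pow_add, pow_mul, ih]
    exact hy

theorem diffUniformity_eq {V : Type*} [AddCommGroup V] [Fintype V] {f : V → V} {n : ℕ}
    (h : ∀ a b, a ≠ 0 → ddt f a b ≤ n) {a b : V} (ha : a ≠ 0) (hab : n ≤ ddt f a b) :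
    diffUniformity f = n :=
  le_antisymm (diffUniformity_le h) (hab.trans (ddt_le_diffUniformity f b ha))

variable {F : Type*} [Field F] [Fintype F] [CharP F 2] {m k : ℕ}

theorem GamPart_zero_uniformity (hm : Odd m) (hk : Odd k) (hmk : Nat.gcd m k = 1)
    (hF : Fintype.card F = 2 ^ (2 * m)) {c : Fin 4 → F} (hc : c ∈ GamPart F m k 0) :
    ∃ h : Function.Bijective (quad m k c),
      boomUniformity (Equiv.ofBijective (quad m k c) h) = diffUniformity (quad m k c) ∧
      diffUniformity (quad m k c) = 4 := by
  obtain ⟨N, L, hNL⟩ := GamPart_zero_equiv hm hk hF hc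
  obtain ⟨σ, hσ⟩ : ∃ σ : F →+* F, σ = iterateFrobenius F 2 (m + k) := ⟨_, rfl⟩
  rw [← hσ] at hNL
  have hσ' : ∀ y, σ y = y ^ 2 ^ (m + k) := fun y => by rw [hσ, iterateFrobenius_def]
  have hcard : ∀ y : F, y ^ 2 ^ (2 * m) = y := fun y => by rw [← hF, FiniteField.pow_card]
  obtain ⟨hg1, hg2⟩ := gcd_add_two_mul hm hk hmk
  have hfix : ∀ y, σ y = y → y ^ 4 = y := fun y hy => by
    have := pow_two_pow_gcd ((hσ' y).symm.trans hy) (hcard y)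
    rwa [hg1] at this
  have hfix' : ∀ y, y ^ 4 = y → σ y = y := fun y hy => by
    rw [hσ', pow_two_pow_eq_of_pow_four hy (hm.add_odd hk)]
  have hσσ : ∀ y, σ (σ y) = y → σ y = y := fun y hy => by
    refine hfix' y ?_
    rw [hσ', hσ', ← pow_mul, ← pow_add, ← two_mul] at hy
    have := pow_two_pow_gcd hy (hcard y)
    rwa [hg2] at this
  have hσm : ∀ y, σ^[m] y = y := fun y => by
    -- As m + k is even, (m + k)m is a multiple of 2m.
    rw [hσ, ← coe_iterateFrobenius_mul, iterateFrobenius_def]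
    obtain ⟨j, hj⟩ := hm.add_odd hk
    rw [hj, ← two_mul, show 2 * j * m = 2 * m * j by ring]
    clear hj
    induction j with
    | zero => simp
    | succ j ih => rw [mul_add_one, pow_add, pow_mul, ih, hcard]
  have hG : Function.Bijective fun x => σ x * x :=
    Finite.injective_iff_bijective.mp (gold_injective σ hσσ)
  have hq : quad m k c = L ∘ (fun x => σ x * x) ∘ N := funext hNL
  have hbij : Function.Bijective (quad m k c) := by
    rw [hq]; exact L.bijective.comp (hG.comp N.bijective)
  have hD : diffUniformity (quad m k c) = 4 := by
    obtain ⟨ω, hω, -, -⟩ := exists_primitive_cube_root hm hF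
    refine diffUniformity_eq (fun a b ha => ?_) (a := N.symm 1) (b := L 1) (by simp) ?_
    · rw [ddt_comp N L (g := fun x => σ x * x) hNL]
      exact ddt_gold_le σ (by norm_num) hfix (by simpa using ha) _
    · rw [ddt_comp N L (g := fun x => σ x * x) hNL, AddEquiv.apply_symm_apply, AddEquiv.symm_apply_apply]
      refine le_ddt_gold σ hω (hfix' _ ?_)
      linear_combination (ω ^ 2 - ω) * hω
  refine ⟨hbij, le_antisymm ?_ ?_, hD⟩
  · rw [hD]
    refine boomUniformity_le fun a b ha hb => ?_
    rw [bct_comp N L (g := Equiv.ofBijective _ hG) hNL]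
    exact bct_gold_le σ _ (fun _ => rfl) hm hfix hσm (by simpa using ha) (by simpa using hb)
  · exact diffUniformity_le_boomUniformity CharTwo.add_self_eq_zero (Equiv.ofBijective _ hbij)

theorem GamPart_one_uniformity (hm : Odd m) (hk : Odd k) (hmk : Nat.gcd m k = 1)
    (hF : Fintype.card F = 2 ^ (2 * m)) {c : Fin 4 → F} (hc : c ∈ GamPart F m k 1) :
    ∃ h : Function.Bijective (quad m k c),
      diffUniformity (quad m k c) ≤ boomUniformity (Equiv.ofBijective (quad m k c) h) ∧
      diffUniformity (quad m k c) = 2 ^ (m + 1) := by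
  classical
  obtain ⟨N, L, hNL⟩ := GamPart_one_equiv hm hk hF hc
  obtain ⟨σ, hσ⟩ : ∃ σ : realSubfield F m →+* realSubfield F m,
    σ = iterateFrobenius (realSubfield F m) 2 k := ⟨_, rfl⟩
  rw [← hσ] at hNL
  have hσ' : ∀ y, σ y = y ^ 2 ^ k := fun y => by rw [hσ, iterateFrobenius_def]
  have hK := card_realSubfield hm.pos.ne' hF
  have hcard : ∀ y : realSubfield F m, y ^ 2 ^ m = y := fun y => by
    rw [← hK, FiniteField.pow_card]
  have hfix : ∀ y, σ y = y → y ^ 2 = y := fun y hy => by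
    have := pow_two_pow_gcd (hcard y) ((hσ' y).symm.trans hy)
    rwa [hmk, pow_one] at this
  have hσσ : ∀ y, σ (σ y) = y → σ y = y := fun y hy => by
    rw [hσ', hσ', ← pow_mul, ← pow_add, ← two_mul] at hy
    have := pow_two_pow_gcd (hcard y) hy
    rw [show Nat.gcd m (2 * k) = 1 from Nat.Coprime.mul_right hm.coprime_two_right hmk,
      pow_one] at this
    rw [hσ']
    generalize k = j
    induction j with
    | zero => simp
    | succ j ih => rw [pow_succ, pow_mul, ih, this]
  have hG : Function.Bijective fun x => σ x * x :=
    Finite.injective_iff_bijective.mp (gold_injective σ hσσ)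
  have hq : quad m k c = L ∘ Prod.map (fun x => σ x * x) (fun x => σ x * x) ∘ N := funext hNL
  have hbij : Function.Bijective (quad m k c) := by
    rw [hq]; exact L.bijective.comp ((hG.prodMap hG).comp N.bijective)
  have hle : 2 ≤ 2 ^ m := Nat.le_self_pow hm.pos.ne' 2
  refine ⟨hbij, diffUniformity_le_boomUniformity CharTwo.add_self_eq_zero
    (Equiv.ofBijective _ hbij), ?_⟩
  have hgold : ∀ a b, a ≠ 0 → ddt (fun x => σ x * x) a b ≤ 2 := fun a b ha =>
    ddt_gold_le σ one_lt_two hfix ha b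
  have hall : ∀ a b, ddt (fun x => σ x * x) a b ≤ 2 ^ m := fun a b =>
    hK ▸ ddt_le_card _ a b
  -- In direction (1, 0) the second coordinate is unconstrained and contributes 2^m, while 0 and 1
  -- solve the equation in the first.
  refine diffUniformity_eq (fun a b ha => ?_) (a := N.symm (1, 0)) (b := L (1, 0))
    (by simp [Prod.ext_iff]) ?_
  · rw [ddt_comp N L hNL, ddt_prodMap, pow_succ]
    have hNa : N a ≠ 0 := by simpa using ha
    by_cases h1 : (N a).1 = 0
    · have h2 : (N a).2 ≠ 0 := fun h => hNa (Prod.ext h1 h)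
      exact Nat.mul_le_mul (hall _ _) (hgold _ _ h2)
    · rw [mul_comm]
      exact Nat.mul_le_mul (hall _ _) (hgold _ _ h1)
  · rw [ddt_comp N L hNL, AddEquiv.apply_symm_apply, AddEquiv.symm_apply_apply, ddt_prodMap,
      pow_succ, mul_comm]
    refine Nat.mul_le_mul ?_ ?_
    · rw [← Finset.card_pair (zero_ne_one (α := realSubfield F m))]
      unfold ddt
      refine Finset.card_le_card fun x hx => ?_
      simp only [Finset.mem_insert, Finset.mem_singleton] at hx
      rcases hx with rfl | rfl <;> simp [CharTwo.add_self_eq_zero]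
    · rw [← hK, ← Finset.card_univ]
      unfold ddt
      refine Finset.card_le_card fun x _ => ?_
      simp [CharTwo.add_self_eq_zero]

end Uniformity

theorem theorem1 {F : Type*} [Field F] [Fintype F] (m k : ℕ) (hm : Odd m) (hk : Odd k)
    (hmk : Nat.gcd m k = 1) (hF : Fintype.card F = 2 ^ (2 * m)) :
    (Gam F m k = GamPart F m k 0 ∪ GamPart F m k 1 ∧
      Disjoint (GamPart F m k 0) (GamPart F m k 1)) ∧
    (∀ c ∈ Gam F m k, Function.Bijective (quad m k c)) ∧
    (∀ c ∈ GamPart F m k 0, ∃ h : Function.Bijective (quad m k c),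
      boomUniformity (Equiv.ofBijective (quad m k c) h) = diffUniformity (quad m k c) ∧
      diffUniformity (quad m k c) = 4) ∧
    (∀ c ∈ GamPart F m k 1, ∃ h : Function.Bijective (quad m k c),
      diffUniformity (quad m k c) ≤ boomUniformity (Equiv.ofBijective (quad m k c) h) ∧
      diffUniformity (quad m k c) = 2 ^ (m + 1)) := by
  have : CharP F 2 := charP_two_of_card hF
  have hunion : Gam F m k = GamPart F m k 0 ∪ GamPart F m k 1 := by
    ext c
    refine ⟨fun hc => ?_, fun hc => hc.elim (fun h => h.1) fun h => h.1⟩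
    exact (Gam_trace_eq hF c).imp (fun h => ⟨hc, h⟩) fun h => ⟨hc, h⟩
  refine ⟨⟨hunion, ?_⟩, fun c hc => ?_, fun c hc => GamPart_zero_uniformity hm hk hmk hF hc,
    fun c hc => GamPart_one_uniformity hm hk hmk hF hc⟩
  · exact Set.disjoint_left.mpr fun c h0 h1 => zero_ne_one (h0.2.symm.trans h1.2)
  · rw [hunion] at hc
    rcases hc with hc | hc
    · exact (GamPart_zero_uniformity hm hk hmk hF hc).1
    · exact (GamPart_one_uniformity hm hk hmk hF hc).1
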